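/- \textbf{Theorem (Bit lower bound for condition-number-bounded Gaussians).} For $d\in\mathbb N$ and $\kappa>0$ let \[ \mathcal C_d(\kappa)=\Bigl\{\mathcal N(0,\Sigma):\ \tfrac1\kappa I\preceq\Sigma\preceq I\Bigr\} \] be the class of centered Gaussians on $\mathbb R^d$ with covariance eigenvalues in $[1/\kappa,1]$, and let $d_{\mathrm{TV}}(P,P')=\sup_A|P(A)-P'(A)|$. A \emph{finite-bit sampler} for $\mathcal C_d(\kappa)$ using at most $Q$ bits is either of the following. (a) \emph{(Finite-transcript sampler.)} There are common randomness $Z$ on an arbitrary probability space, whose law does not depend on the target $\pi\in\mathcal C_d(\kappa)$, a finite alphabet $\mathcal T$ with $|\mathcal T|\le 2^Q$, a transcript $T=T(\pi,Z)\in\mathcal T$, and an output $\widehat Y=\widehat Y(T,Z)\in\mathbb R^d$ depending on $\pi$ only through $T$. (b) \emph{(Finite-bit smoothed-score sampler.)} An adaptive algorithm with arbitrary internal randomness makes $q$ queries. At query $t$ it chooses, as functions of its randomness and of the previous messages, a noise level $\tau_t>0$, a point $y_t\in\mathbb R^d$, a bit budget $B_t\in\mathbb N$ and an encoder $\mathsf{Enc}_t:\mathbb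 R^d\to\{0,1\}^{B_t}$, and receives only the message $\mathsf{Enc}_t(s_{\tau_t}(y_t))$, where $s_\tau=\nabla\log\bigl(\pi*\mathcal N(0,\tau I)\bigr)$. The output $\widehat Y$ is a function of its randomness and of all messages, and $\sum_{t=1}^q B_t\le Q$ always, for every target $\pi\in\mathcal C_d(\kappa)$. The sampler is \emph{$\delta_{\mathrm{TV}}$-accurate} if, writing $\widehat Y$ for its output when the target is $\pi$, \[ \sup_{\pi\in\mathcal C_d(\kappa)} d_{\mathrm{TV}}\bigl(\mathcal L(\widehat Y),\pi\bigr)\le\delta_{\mathrm{TV}} . \] For every $\delta_{\mathrm{TV}}\in[0,1)$ there are constants $c_{\delta_{\mathrm{TV}}}>0$ and $\kappa_{\delta_{\mathrm{TV}}}<\infty$, depending only on $\delta_{\mathrm{TV}}$ and in particular not on $d$, such that for all $d\ge2$, all $\kappa\ge\kappa_{\delta_{\mathrm{TV}}}$ and all $Q$, every $\delta_{\mathrm{TV}}$-accurate finite-bit sampler for $\mathcal C_d(\kappa)$ that uses at most $Q$ bits, of type (a) or (b), satisfies \[ Q\ \ge\ c_{\delta_{\mathrm{TV}}}\, d\,\log_2\kappa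 . \] -/

import Mathlib

open MeasureTheory ProbabilityTheory
open scoped MatrixOrder

noncomputable section

/-- Total variation distance `sup_A |P(A) - Q(A)|`, the supremum being over measurable sets.
It is used for probability measures only, where the supremum is over a bounded set of reals. -/
def tvDist {E : Type*} [MeasurableSpace E] (P Q : Measure E) : ℝ :=
  ⨆ A : {A : Set E // MeasurableSet A}, |P.real A.1 - Q.real A.1|

/-- The covariance matrices `Σ` with `I / κ ⪯ Σ ⪯ I` in the Loewner order
(`A ≤ B` means that `B - A` is symmetric positive semidefinite). -/
def CovClass (d : ℕ) (κ : ℝ) : Type :=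
  {S : Matrix (Fin d) (Fin d) ℝ // (1 / κ) • (1 : Matrix (Fin d) (Fin d) ℝ) ≤ S ∧ S ≤ 1}

/-- The centered Gaussian `N(0, Σ)`; these are the members of the target class. -/
def gaussianTarget {d : ℕ} {κ : ℝ} (S : CovClass d κ) : Measure (EuclideanSpace ℝ (Fin d)) :=
  multivariateGaussian 0 S.1

/-- A family of random outputs `Y x`, indexed by the inputs `x` and defined on the probability
space `(Ω, P)`, is `δ`-accurate for the family of targets `p x` when
`d_TV (L(Y x), p x) ≤ δ` for every `x`. -/
def IsTVAccurate {X Ω E : Type*} [MeasurableSpace Ω] [MeasurableSpace E] (P : Measure Ω)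
    (Y : X → Ω → E) (p : X → Measure E) (δ : ℝ) : Prop :=
  ∀ x, AEMeasurable (Y x) P ∧ tvDist (P.map (Y x)) (p x) ≤ δ

/-! ### Finite-transcript samplers (channel simulators) -/

/-- A sampler with common randomness `ω : Ω` and transcript alphabet `T`: the encoder sees the
input `x` and `ω` and sends a transcript in `T`; the decoder sees the transcript and `ω` only. -/
structure TranscriptSampler (X Ω T E : Type*) where
  transcript : X → Ω → T
  decode : T → Ω → E

/-- The output `Ŷ = Ŷ(T(x, ω), ω)`. -/
def TranscriptSampler.output {X Ω T E : Type*} (A : TranscriptSampler X Ω T E) (x : X) (ω : Ω) :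
    E :=
  A.decode (A.transcript x ω) ω

/-! ### Finite-bit smoothed-score samplers -/

/-- The density at `y` of `π * N(0, τ I)`, that is, the integral against `π(dx)` of the density
of `N(x, τ I)` at `y`. -/
def smoothedDensity {d : ℕ} (π : Measure (EuclideanSpace ℝ (Fin d))) (τ : ℝ)
    (y : EuclideanSpace ℝ (Fin d)) : ℝ :=
  ∫ x, (Real.sqrt (2 * Real.pi * τ) ^ d)⁻¹ * Real.exp (-‖y - x‖ ^ 2 / (2 * τ)) ∂π

/-- The smoothed score `s_τ(y) = ∇ log (π * N(0, τ I))(y)`. -/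
def smoothedScore {d : ℕ} (π : Measure (EuclideanSpace ℝ (Fin d))) (τ : ℝ)
    (y : EuclideanSpace ℝ (Fin d)) : EuclideanSpace ℝ (Fin d) :=
  gradient (fun z => Real.log (smoothedDensity π τ z)) y

/-- A message of the oracle: a number `B` of bits and a word in `{0,1}^B`. -/
abbrev BitMessage : Type := (B : ℕ) × (Fin B → Bool)

/-- A query: a noise level `τ > 0`, a query point, a bit budget `B` and an encoder
`ℝ^d → {0,1}^B`. -/
structure BitQuery (d : ℕ) where
  noise : ℝ
  noise_pos : 0 < noise
  point : EuclideanSpace ℝ (Fin d)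
  bits : ℕ
  encode : EuclideanSpace ℝ (Fin d) → (Fin bits → Bool)

/-- The oracle's answer to a query: the encoded smoothed score of the target `π`. -/
def BitQuery.answer {d : ℕ} (a : BitQuery d) (π : Measure (EuclideanSpace ℝ (Fin d))) :
    BitMessage :=
  ⟨a.bits, a.encode (smoothedScore π a.noise a.point)⟩

/-- An adaptive algorithm with internal randomness `ω : Ω` that makes `numQueries` queries. Each
query is a function of `ω` and of the list of previous messages, and so is the final output. -/
structure ScoreSampler (d : ℕ) (Ω : Type*) where
  numQueries : ℕ
  query : Ω → List BitMessage → BitQuery d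
  decode : Ω → List BitMessage → EuclideanSpace ℝ (Fin d)

namespace ScoreSampler

variable {d : ℕ} {Ω : Type*}

/-- The list of the first `t` messages when the target is `π`. -/
def messages (A : ScoreSampler d Ω) (π : Measure (EuclideanSpace ℝ (Fin d))) (ω : Ω) :
    ℕ → List BitMessage
  | 0 => []
  | t + 1 => A.messages π ω t ++ [(A.query ω (A.messages π ω t)).answer π]

/-- The total number of transmitted bits, `∑ t, B_t`. -/
def totalBits (A : ScoreSampler d Ω) (π : Measure (EuclideanSpace ℝ (Fin d))) (ω : Ω) : ℕ :=
  ((A.messages π ω A.numQueries).map Sigma.fst).sum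

/-- The random output for the target `π`. -/
def output (A : ScoreSampler d Ω) (π : Measure (EuclideanSpace ℝ (Fin d))) (ω : Ω) :
    EuclideanSpace ℝ (Fin d) :=
  A.decode ω (A.messages π ω A.numQueries)

end ScoreSampler

end

/-! The bound is a packing argument. Split the coordinates into `m = d / 2` pairs and put on each
pair a Gaussian concentrated near a line whose slope is one of `R ^ 2` values. With `κ = u ^ 16`,
the thickness is of order `κ ^ (-1/2) = u ^ (-8)`, while slopes are at least `u ^ (-4)` apart. Away
from the origin the strips around different lines are therefore disjoint, and one sample reveals the
slope of most pairs.

Asking for all slopes at once would cost a union bound over `m` pairs. Asking for half of them costs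
only a factor 2 by Markov (`one_sub_two_mul_le_measureReal_majoritySet`), which keeps the constants
free of `d`. A Chernoff-type count (`sum_indicator_majoritySet_le`) shows that a point is still
compatible with at most `(2R)^m` of the `R^(2m)` slope words.

For fixed randomness, `Q` bits allow at most `2^Q` outputs; for adaptive budgets this is Kraft's
inequality. Accuracy makes each word succeed with probability at least `(1 - δ) / 2`, so double
counting (`sum_measureReal_map_le`) gives `R^(2m) (1 - δ) / 2 ≤ 2^Q (2R)^m`, whence `u^m ≤ 2^Q`. -/

/-! ### Majority decoding -/

/-- The points that lie in at least half of the sets `G j`. -/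
def majoritySet {E : Type*} {m : ℕ} (G : Fin m → Set E) : Set E :=
  {y | (m : ℝ) ≤ 2 * ∑ j, (G j).indicator (fun _ => (1 : ℝ)) y}

lemma measurableSet_majoritySet {E : Type*} [MeasurableSpace E] {m : ℕ} {G : Fin m → Set E}
    (hG : ∀ j, MeasurableSet (G j)) : MeasurableSet (majoritySet G) := by
  refine measurableSet_le measurable_const (Measurable.const_mul ?_ _)
  exact Finset.measurable_sum _ fun j _ => measurable_const.indicator (hG j)

/-- Markov's inequality for the number of missed sets: its mean is at most `m * p`, and leaving the
majority set means missing more than `m / 2`. No independence is needed. -/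
lemma one_sub_two_mul_le_measureReal_majoritySet {E : Type*} [MeasurableSpace E] (μ : Measure E)
    [IsProbabilityMeasure μ] {m : ℕ} (hm : 0 < m) {G : Fin m → Set E}
    (hG : ∀ j, MeasurableSet (G j)) {p : ℝ} (hp : ∀ j, 1 - p ≤ μ.real (G j)) :
    1 - 2 * p ≤ μ.real (majoritySet G) := by
  have hint : ∀ {s : Set E}, MeasurableSet s →
      Integrable (s.indicator fun _ => (1 : ℝ)) μ := fun hs =>
    (integrable_const 1).indicator hs
  have hval : ∀ {s : Set E}, MeasurableSet s →
      ∫ y, s.indicator (fun _ => (1 : ℝ)) y ∂μ = μ.real s := fun hs => by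
    rw [integral_indicator hs]; simp
  have hA := measurableSet_majoritySet hG
  have hle : ∀ y, 2 * ∑ j, (G j).indicator (fun _ => (1 : ℝ)) y ≤
      m + m * (majoritySet G).indicator (fun _ => (1 : ℝ)) y := by
    intro y
    have hsum : ∑ j, (G j).indicator (fun _ => (1 : ℝ)) y ≤ m := by
      calc _ ≤ ∑ _j : Fin m, (1 : ℝ) := Finset.sum_le_sum fun j _ =>
            Set.indicator_le_self' (fun _ _ => zero_le_one) y
        _ = m := by simp
    by_cases hy : y ∈ majoritySet G
    · simp only [Set.indicator_of_mem hy]; linarith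
    · have hy' : ¬ (m : ℝ) ≤ 2 * ∑ j, (G j).indicator (fun _ => (1 : ℝ)) y := hy
      simp only [Set.indicator_of_notMem hy]; linarith
  have hI := integral_mono (μ := μ)
    ((integrable_finsetSum _ fun j _ => hint (hG j)).const_mul 2)
    ((integrable_const (m : ℝ)).add ((hint hA).const_mul (m : ℝ))) hle
  rw [integral_const_mul, integral_finsetSum _ fun j _ => hint (hG j)] at hI
  simp only [Pi.add_apply] at hI
  rw [integral_add (integrable_const _) ((hint hA).const_mul _), integral_const_mul, hval hA] at hI
  simp only [hval (hG _), integral_const, probReal_univ, one_smul] at hI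
  have hs : (m : ℝ) * (1 - p) ≤ ∑ j, μ.real (G j) := by
    calc (m : ℝ) * (1 - p) = ∑ _j : Fin m, (1 - p) := by simp [mul_sub]
      _ ≤ _ := Finset.sum_le_sum fun j _ => hp j
  have hm' : (0 : ℝ) < m := by exact_mod_cast hm
  refine le_of_mul_le_mul_left ?_ hm'
  linarith

/-- If for every `j` the sets `G j k` are pairwise disjoint, a point lies in few of the majority
sets attached to the words `i : Fin m → Fin (R ^ 2)`. -/
lemma sum_indicator_majoritySet_le {E : Type*} {m R : ℕ} (hR : 0 < R)
    (G : Fin m → Fin (R ^ 2) → Set E) (y : E)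
    (hG : ∀ j k l, y ∈ G j k → y ∈ G j l → k = l) :
    ∑ i : Fin m → Fin (R ^ 2),
      (majoritySet fun j => G j (i j)).indicator (fun _ => (1 : ℝ)) y ≤ (2 * R : ℝ) ^ m := by
  classical
  have hR' : (1 : ℝ) ≤ R := by exact_mod_cast hR
  -- Exponential weights: each hit counts `R ^ 2`, so `m / 2` hits give at least `R ^ m`, and the
  -- sum over words factorizes over `j`.
  let f : Fin m → Fin (R ^ 2) → ℝ := fun j k => if y ∈ G j k then (R : ℝ) ^ 2 else 1
  have hterm : ∀ i : Fin m → Fin (R ^ 2),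
      (majoritySet fun j => G j (i j)).indicator (fun _ => (1 : ℝ)) y * (R : ℝ) ^ m ≤
        ∏ j, f j (i j) := by
    intro i
    have hprod : ∏ j, f j (i j) =
        (R : ℝ) ^ (2 * (Finset.univ.filter fun j => y ∈ G j (i j)).card) := by
      simp only [f]
      rw [Finset.prod_ite]; simp [pow_mul]
    by_cases hy : y ∈ majoritySet fun j => G j (i j)
    · rw [Set.indicator_of_mem hy, one_mul, hprod]
      refine pow_le_pow_right₀ hR' ?_
      have h : (m : ℝ) ≤ 2 * ∑ j, (G j (i j)).indicator (fun _ => (1 : ℝ)) y := hy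
      simp only [Set.indicator_apply, Finset.sum_boole] at h
      exact_mod_cast h
    · rw [Set.indicator_of_notMem hy, zero_mul, hprod]; positivity
  have hsum : ∀ j, ∑ k, f j k ≤ 2 * (R : ℝ) ^ 2 := by
    intro j
    have hcard : (Finset.univ.filter fun k => y ∈ G j k).card ≤ 1 := by
      rw [Finset.card_le_one]
      intro k hk l hl
      exact hG j k l (by simpa using hk) (by simpa using hl)
    calc ∑ k, f j k ≤ ∑ k, ((if y ∈ G j k then (R : ℝ) ^ 2 else 0) + 1) := by
          refine Finset.sum_le_sum fun k _ => ?_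
          simp only [f]; split_ifs <;> simp
      _ = (Finset.univ.filter fun k => y ∈ G j k).card * (R : ℝ) ^ 2 + (R : ℝ) ^ 2 := by
          rw [Finset.sum_add_distrib, ← Finset.sum_filter]; simp
      _ ≤ 1 * (R : ℝ) ^ 2 + (R : ℝ) ^ 2 := by
          gcongr; exact_mod_cast hcard
      _ = _ := by ring
  have hpos : (0 : ℝ) < (R : ℝ) ^ m := by positivity
  refine le_of_mul_le_mul_right ?_ hpos
  calc _ = ∑ i : Fin m → Fin (R ^ 2),
        (majoritySet fun j => G j (i j)).indicator (fun _ => (1 : ℝ)) y * (R : ℝ) ^ m :=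
        Finset.sum_mul _ _ _
    _ ≤ ∑ i : Fin m → Fin (R ^ 2), ∏ j, f j (i j) := Finset.sum_le_sum fun i _ => hterm i
    _ = ∏ j, ∑ k, f j k := by
        rw [Finset.prod_univ_sum, Fintype.piFinset_univ]
    _ ≤ ∏ _j : Fin m, 2 * (R : ℝ) ^ 2 := by
        refine Finset.prod_le_prod (fun j _ => Finset.sum_nonneg fun k _ => ?_) fun j _ => hsum j
        simp only [f]; split_ifs <;> positivity
    _ = (2 * R : ℝ) ^ m * (R : ℝ) ^ m := by
        rw [Finset.prod_const, Finset.card_univ, Fintype.card_fin, ← mul_pow]; ring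

/-! ### Success probabilities and the number of outputs -/

lemma abs_measureReal_sub_le_tvDist {E : Type*} [MeasurableSpace E] (μ ν : Measure E)
    [IsProbabilityMeasure μ] [IsProbabilityMeasure ν] {A : Set E} (hA : MeasurableSet A) :
    |μ.real A - ν.real A| ≤ tvDist μ ν := by
  refine le_ciSup (f := fun B : {B : Set E // MeasurableSet B} => |μ.real B.1 - ν.real B.1|)
    ⟨1, ?_⟩ ⟨A, hA⟩
  rintro _ ⟨B, rfl⟩
  have h1 := measureReal_nonneg (μ := μ) (s := B.1)
  have h2 := measureReal_nonneg (μ := ν) (s := B.1)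
  have h3 := measureReal_le_one (μ := μ) (s := B.1)
  have h4 := measureReal_le_one (μ := ν) (s := B.1)
  rw [abs_le]; constructor <;> linarith

/-- If the outputs take at most `M` values at every sample point, and each point lies in at most
`L` of the sets `A i`, then the success probabilities add up to at most `M * L`. -/
lemma sum_measureReal_map_le {ι Ω E : Type*} [Fintype ι] [DecidableEq E] [MeasurableSpace Ω]
    [MeasurableSpace E] (P : Measure Ω) [IsProbabilityMeasure P] {Y : ι → Ω → E}
    (hY : ∀ i, AEMeasurable (Y i) P) {A : ι → Set E} (hA : ∀ i, MeasurableSet (A i)) {M L : ℝ}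
    (hL : 0 ≤ L) (hM : ∀ ω, ((Finset.univ.image fun i => Y i ω).card : ℝ) ≤ M)
    (hAL : ∀ y, ∑ i, (A i).indicator (fun _ => (1 : ℝ)) y ≤ L) :
    ∑ i, (P.map (Y i)).real (A i) ≤ M * L := by
  have : ∀ i, IsProbabilityMeasure (P.map (Y i)) := fun i => Measure.isProbabilityMeasure_map (hY i)
  have hint : ∀ i, Integrable ((A i).indicator fun _ => (1 : ℝ)) (P.map (Y i)) := fun i =>
    (integrable_const 1).indicator (hA i)
  have hint' : ∀ i, Integrable (fun ω => (A i).indicator (fun _ => (1 : ℝ)) (Y i ω)) P :=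
    fun i => (hint i).comp_aemeasurable (hY i)
  have hval : ∀ i, (P.map (Y i)).real (A i) =
      ∫ ω, (A i).indicator (fun _ => (1 : ℝ)) (Y i ω) ∂P := fun i => by
    rw [← integral_map (hY i) (hint i).aestronglyMeasurable, integral_indicator (hA i)]; simp
  simp only [hval]
  rw [← integral_finsetSum _ fun i _ => hint' i]
  -- Double counting at fixed `ω`: enlarge each term to a sum over all outputs, then exchange the
  -- sums.
  have hle : ∀ ω, ∑ i, (A i).indicator (fun _ => (1 : ℝ)) (Y i ω) ≤ M * L := by
    intro ω
    have hnn : ∀ i y, 0 ≤ (A i).indicator (fun _ => (1 : ℝ)) y := fun i y =>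
      Set.indicator_nonneg (fun _ _ => zero_le_one) y
    calc ∑ i, (A i).indicator (fun _ => (1 : ℝ)) (Y i ω)
        ≤ ∑ i, ∑ y ∈ Finset.univ.image fun i => Y i ω, (A i).indicator (fun _ => (1 : ℝ)) y :=
          Finset.sum_le_sum fun i _ => Finset.single_le_sum
            (f := fun y => (A i).indicator (fun _ => (1 : ℝ)) y) (fun y _ => hnn i y)
            (Finset.mem_image_of_mem (fun i => Y i ω) (Finset.mem_univ i))
      _ = ∑ y ∈ Finset.univ.image fun i => Y i ω, ∑ i, (A i).indicator (fun _ => (1 : ℝ)) y :=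
          Finset.sum_comm
      _ ≤ ∑ _y ∈ Finset.univ.image fun i => Y i ω, L := Finset.sum_le_sum fun y _ => hAL y
      _ = ((Finset.univ.image fun i => Y i ω).card : ℝ) * L := by simp
      _ ≤ M * L := mul_le_mul_of_nonneg_right (hM ω) hL
  calc _ ≤ ∫ _ω, M * L ∂P := integral_mono (integrable_finsetSum _ fun i _ => hint' i)
        (integrable_const _) hle
    _ = M * L := by simp

/-! ### Bit counting for adaptive score samplers -/

namespace ScoreSampler

variable {d : ℕ} {Ω : Type*}

/-- Kraft's inequality for the message lists of an adaptive algorithm. -/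
lemma sum_two_inv_pow_bits_le_one {ι : Type*} (A : ScoreSampler d Ω)
    (π : ι → Measure (EuclideanSpace ℝ (Fin d))) (ω : Ω) (s : Finset ι) (t : ℕ) :
    ∑ l ∈ s.image (fun i => A.messages (π i) ω t), (2⁻¹ : ℝ) ^ (l.map Sigma.fst).sum ≤ 1 := by
  classical
  induction t with
  | zero =>
    simp only [messages]
    calc _ ≤ ∑ l ∈ {([] : List BitMessage)}, (2⁻¹ : ℝ) ^ (l.map Sigma.fst).sum :=
          Finset.sum_le_sum_of_subset_of_nonneg (fun l hl => by
            obtain ⟨_, _, rfl⟩ := Finset.mem_image.1 hl; simp) fun _ _ _ => by positivity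
      _ = 1 := by simp
  | succ t ih =>
    -- With `ω` fixed, the past messages determine the next budget `B`; the `2 ^ B` possible
    -- continuations share the weight of `l` equally.
    let ext : List BitMessage → Finset (List BitMessage) := fun l =>
      (Finset.univ : Finset (Fin (A.query ω l).bits → Bool)).image
        fun w => l ++ [⟨(A.query ω l).bits, w⟩]
    have hsub : s.image (fun i => A.messages (π i) ω (t + 1)) ⊆
        (s.image fun i => A.messages (π i) ω t).biUnion ext := by
      intro l hl
      obtain ⟨i, hi, rfl⟩ := Finset.mem_image.1 hl
      refine Finset.mem_biUnion.2 ⟨_, Finset.mem_image_of_mem _ hi, ?_⟩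
      exact Finset.mem_image.2 ⟨_, Finset.mem_univ _, rfl⟩
    have hext : ∀ l, ∑ l' ∈ ext l, (2⁻¹ : ℝ) ^ (l'.map Sigma.fst).sum ≤
        (2⁻¹ : ℝ) ^ (l.map Sigma.fst).sum := by
      intro l
      calc _ ≤ ∑ w : Fin (A.query ω l).bits → Bool,
            (2⁻¹ : ℝ) ^ ((l ++ [(⟨(A.query ω l).bits, w⟩ : BitMessage)]).map Sigma.fst).sum :=
            (Finset.sum_image (f := fun l' : List BitMessage => (2⁻¹ : ℝ) ^ (l'.map Sigma.fst).sum)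
              fun _ _ _ _ h => by simpa using h).le
        _ = (2⁻¹ : ℝ) ^ (l.map Sigma.fst).sum := by
            simp [pow_add]
            field_simp
    calc _ ≤ ∑ l ∈ (s.image fun i => A.messages (π i) ω t).biUnion ext,
          (2⁻¹ : ℝ) ^ (l.map Sigma.fst).sum :=
          Finset.sum_le_sum_of_subset_of_nonneg hsub fun _ _ _ => by positivity
      _ ≤ ∑ l ∈ s.image fun i => A.messages (π i) ω t,
          ∑ l' ∈ ext l, (2⁻¹ : ℝ) ^ (l'.map Sigma.fst).sum :=
          (Finset.sum_biUnion fun l _ l' _ hne => Finset.disjoint_left.2 fun k hk hk' => by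
            obtain ⟨w, -, rfl⟩ := Finset.mem_image.1 hk
            obtain ⟨w', -, h⟩ := Finset.mem_image.1 hk'
            exact hne (List.append_inj_left' h rfl).symm).le
      _ ≤ ∑ l ∈ s.image fun i => A.messages (π i) ω t, (2⁻¹ : ℝ) ^ (l.map Sigma.fst).sum :=
          Finset.sum_le_sum fun l _ => hext l
      _ ≤ 1 := ih

/-- With at most `Q` transmitted bits there are at most `2 ^ Q` outputs at every sample point. -/
lemma card_image_output_le {ι : Type*} [DecidableEq (EuclideanSpace ℝ (Fin d))]
    (A : ScoreSampler d Ω) (π : ι → Measure (EuclideanSpace ℝ (Fin d))) (ω : Ω) (s : Finset ι)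
    {Q : ℕ} (hQ : ∀ i ∈ s, A.totalBits (π i) ω ≤ Q) :
    ((s.image fun i => A.output (π i) ω).card : ℝ) ≤ (2 : ℝ) ^ Q := by
  classical
  set F := s.image fun i => A.messages (π i) ω A.numQueries with hF
  have himage : (s.image fun i => A.output (π i) ω) = F.image (A.decode ω) := by
    rw [hF, Finset.image_image]; rfl
  have hK := A.sum_two_inv_pow_bits_le_one π ω s A.numQueries
  have hlow : (F.card : ℝ) * (2⁻¹ : ℝ) ^ Q ≤ 1 := by
    refine le_trans ?_ hK
    rw [← nsmul_eq_mul, ← Finset.sum_const]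
    refine Finset.sum_le_sum fun l hl => ?_
    obtain ⟨i, hi, rfl⟩ := Finset.mem_image.1 hl
    exact pow_le_pow_of_le_one (by norm_num) (by norm_num) (hQ i hi)
  have hcard : ((F.image (A.decode ω)).card : ℝ) ≤ F.card := by
    exact_mod_cast Finset.card_image_le
  rw [himage]
  refine hcard.trans ?_
  rwa [inv_pow, ← div_eq_mul_inv, div_le_one (by positivity)] at hlow

end ScoreSampler

/-! ### The hard family of covariances -/

section Covariance

open Matrix

variable {d m : ℕ}

/-- The covariance `I / κ + (1 / 4) ∑ⱼ vⱼ vⱼᵀ` with `vⱼ = e_{a j} + tⱼ e_{b j}`. -/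
noncomputable def pairedCov (κ : ℝ) (a b : Fin m → Fin d) (t : Fin m → ℝ) : Matrix (Fin d) (Fin d) ℝ :=
  (1 / κ) • (1 : Matrix (Fin d) (Fin d) ℝ) + (1 / 4 : ℝ) • ∑ j,
    vecMulVec (Pi.single (a j) 1 + t j • Pi.single (b j) 1)
      (Pi.single (a j) 1 + t j • Pi.single (b j) 1)

lemma isHermitian_pairedCov (κ : ℝ) (a b : Fin m → Fin d) (t : Fin m → ℝ) :
    (pairedCov κ a b t).IsHermitian := by
  ext i k
  simp [pairedCov, Matrix.sum_apply, vecMulVec_apply, mul_comm, Matrix.one_apply, eq_comm]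

lemma dotProduct_pairedCov_mulVec (κ : ℝ) (a b : Fin m → Fin d) (t : Fin m → ℝ)
    (x : Fin d → ℝ) :
    x ⬝ᵥ pairedCov κ a b t *ᵥ x =
      1 / κ * ∑ i, x i ^ 2 + 1 / 4 * ∑ j, (x (a j) + t j * x (b j)) ^ 2 := by
  have hv : ∀ v : Fin d → ℝ, x ⬝ᵥ vecMulVec v v *ᵥ x = (v ⬝ᵥ x) ^ 2 := fun v => by
    rw [vecMulVec_mulVec, dotProduct_smul, dotProduct_comm x v]; simp [sq]
  simp only [pairedCov, add_mulVec, dotProduct_add, smul_mulVec, dotProduct_smul, sum_mulVec,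
    dotProduct_sum, hv, one_mulVec, smul_eq_mul]
  simp [dotProduct, ← sq, add_mul, Finset.sum_add_distrib, Pi.single_apply]

lemma sum_sq_add_sq_le (a b : Fin m → Fin d) (hab : Function.Injective (Sum.elim a b))
    (x : Fin d → ℝ) : ∑ j, (x (a j) ^ 2 + x (b j) ^ 2) ≤ ∑ i, x i ^ 2 := by
  classical
  calc ∑ j, (x (a j) ^ 2 + x (b j) ^ 2) = ∑ s : Fin m ⊕ Fin m, x (Sum.elim a b s) ^ 2 := by
        simp [Fintype.sum_sum_type, Finset.sum_add_distrib]
    _ = ∑ i ∈ Finset.univ.image (Sum.elim a b), x i ^ 2 :=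
        (Finset.sum_image (f := fun i => x i ^ 2) hab.injOn).symm
    _ ≤ ∑ i, x i ^ 2 :=
        Finset.sum_le_sum_of_subset_of_nonneg (Finset.subset_univ _) fun i _ _ => sq_nonneg _

/-- Since `‖vⱼ‖² ≤ 2` and the `vⱼ` have disjoint supports, the rank-one part is at most `1 / 2`; the
other half of the budget covers `1 / κ ≤ 1 / 2`. -/
lemma pairedCov_mem {κ : ℝ} (hκ : 2 ≤ κ) {a b : Fin m → Fin d}
    (hab : Function.Injective (Sum.elim a b)) {t : Fin m → ℝ} (ht : ∀ j, |t j| ≤ 1) :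
    (1 / κ) • (1 : Matrix (Fin d) (Fin d) ℝ) ≤ pairedCov κ a b t ∧ pairedCov κ a b t ≤ 1 := by
  have hq := dotProduct_pairedCov_mulVec κ a b t
  have hH := isHermitian_pairedCov κ a b t
  have hone : ∀ (c : ℝ) (x : Fin d → ℝ),
      x ⬝ᵥ (c • (1 : Matrix (Fin d) (Fin d) ℝ)) *ᵥ x = c * ∑ i, x i ^ 2 := fun c x => by
    rw [smul_mulVec, one_mulVec, dotProduct_smul]; simp [dotProduct, sq]
  have hsymm : ∀ c : ℝ, (c • (1 : Matrix (Fin d) (Fin d) ℝ)).IsHermitian := fun c => by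
    ext i k; simp [Matrix.one_apply, eq_comm]
  constructor
  · rw [Matrix.le_iff]
    refine PosSemidef.of_dotProduct_mulVec_nonneg (hH.sub (hsymm _)) fun x => ?_
    simp only [star_trivial, sub_mulVec, dotProduct_sub, hq, hone]
    have : 0 ≤ ∑ j, (x (a j) + t j * x (b j)) ^ 2 := Finset.sum_nonneg fun j _ => sq_nonneg _
    linarith
  · rw [Matrix.le_iff]
    refine PosSemidef.of_dotProduct_mulVec_nonneg (isHermitian_one.sub hH) fun x => ?_
    have h1 := hone 1 x
    rw [one_smul, one_mul] at h1
    simp only [star_trivial, sub_mulVec, dotProduct_sub, hq, h1]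
    have hs : ∑ j, (x (a j) + t j * x (b j)) ^ 2 ≤ 2 * ∑ i, x i ^ 2 := by
      refine le_trans ?_ (mul_le_mul_of_nonneg_left (sum_sq_add_sq_le a b hab x) zero_le_two)
      rw [Finset.mul_sum]
      refine Finset.sum_le_sum fun j _ => ?_
      have h2 : t j ^ 2 ≤ 1 := (sq_le_one_iff_abs_le_one _).2 (ht j)
      nlinarith [sq_nonneg (x (a j) - t j * x (b j)), sq_nonneg (x (b j)),
        mul_nonneg (sub_nonneg.2 h2) (sq_nonneg (x (b j)))]
    have hk : 1 / κ ≤ 1 / 2 := one_div_le_one_div_of_le two_pos hκ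
    have hn : 0 ≤ ∑ i, x i ^ 2 := Finset.sum_nonneg fun i _ => sq_nonneg _
    nlinarith [mul_le_mul_of_nonneg_right hk hn]

lemma posSemidef_pairedCov {κ : ℝ} (hκ : 0 ≤ κ) (a b : Fin m → Fin d) (t : Fin m → ℝ) :
    (pairedCov κ a b t).PosSemidef := by
  refine PosSemidef.of_dotProduct_mulVec_nonneg (isHermitian_pairedCov κ a b t) fun x => ?_
  rw [star_trivial, dotProduct_pairedCov_mulVec]
  have : 0 ≤ ∑ i, x i ^ 2 := Finset.sum_nonneg fun j _ => sq_nonneg _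
  have : 0 ≤ ∑ j, (x (a j) + t j * x (b j)) ^ 2 := Finset.sum_nonneg fun j _ => sq_nonneg _
  positivity

lemma pairedCov_apply_left {a b : Fin m → Fin d} (hab : Function.Injective (Sum.elim a b)) (κ : ℝ) (t : Fin m → ℝ) (j : Fin m) :
    pairedCov κ a b t (a j) (a j) = 1 / κ + 1 / 4 := by
  have ha : ∀ k, a j = a k ↔ k = j := fun k =>
    ⟨fun h => (Sum.inl_injective (@hab (Sum.inl j) (Sum.inl k) h)).symm, fun h => by rw [h]⟩
  have hb : ∀ k, a j ≠ b k := fun k h => by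
    simpa using @hab (Sum.inl j) (Sum.inr k) h
  simp [pairedCov, Matrix.sum_apply, vecMulVec_apply, Pi.single_apply, ha, hb]

/-- The vector `e_{b j} - tⱼ e_{a j}` is orthogonal to every `vₖ`, so only the `I / κ` part
contributes variance in this direction. -/
lemma dotProduct_pairedCov_mulVec_normal {a b : Fin m → Fin d}
    (hab : Function.Injective (Sum.elim a b)) (κ : ℝ) (t : Fin m → ℝ) (j : Fin m) :
    (Pi.single (b j) 1 - t j • Pi.single (a j) 1 : Fin d → ℝ) ⬝ᵥ pairedCov κ a b t *ᵥ
      (Pi.single (b j) 1 - t j • Pi.single (a j) 1) = 1 / κ * (1 + t j ^ 2) := by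
  have ha : ∀ k, a k = a j ↔ k = j := fun k =>
    ⟨fun h => Sum.inl_injective (@hab (Sum.inl k) (Sum.inl j) h), fun h => by rw [h]⟩
  have hb : ∀ k, b k = b j ↔ k = j := fun k =>
    ⟨fun h => Sum.inr_injective (@hab (Sum.inr k) (Sum.inr j) h), fun h => by rw [h]⟩
  have hab' : ∀ k l, a k ≠ b l := fun k l h => by
    simpa using @hab (Sum.inl k) (Sum.inr l) h
  have hba : ∀ k l, b k ≠ a l := fun k l h => hab' l k h.symm
  rw [dotProduct_pairedCov_mulVec]
  have h1 : ∀ k, ((Pi.single (b j) 1 - t j • Pi.single (a j) 1 : Fin d → ℝ) (a k) + t k *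
      (Pi.single (b j) 1 - t j • Pi.single (a j) 1 : Fin d → ℝ) (b k)) ^ 2 = 0 := by
    intro k
    by_cases hk : k = j
    · subst hk; simp [hab', hba]
    · simp [hab', hba, ha, hb, hk]
  have h2 : ∀ i, (Pi.single (b j) 1 - t j • Pi.single (a j) 1 : Fin d → ℝ) i ^ 2 =
      (if i = b j then 1 else 0) + (if i = a j then t j ^ 2 else 0) := by
    intro i
    by_cases hi : i = b j
    · subst hi; simp [hba]
    · simp [Pi.single_apply, hi]
  simp only [h1, h2, Finset.sum_add_distrib]
  simp

end Covariance

/-! ### Gaussian small-ball and Chebyshev bounds -/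

section Tails

variable {d : ℕ}

/-- The density is at most 1 because `2πv ≥ 1`. -/
lemma gaussianReal_real_Icc_le {v : NNReal} (hv : 1 / 4 ≤ v) {r : ℝ} (hr : 0 ≤ r) :
    (gaussianReal 0 v).real (Set.Icc (-r) r) ≤ 2 * r := by
  have hv0 : v ≠ 0 := by rintro rfl; norm_num at hv
  have hpdf : ∀ x, gaussianPDFReal 0 v x ≤ 1 := by
    intro x
    rw [gaussianPDFReal]
    have hv' : (1 / 4 : ℝ) ≤ v := by exact_mod_cast hv
    have hs : 1 ≤ Real.sqrt (2 * Real.pi * v) := by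
      rw [Real.one_le_sqrt]; nlinarith [Real.pi_gt_three]
    refine mul_le_one₀ (inv_le_one_of_one_le₀ hs) (Real.exp_pos _).le (Real.exp_le_one_iff.2 ?_)
    exact div_nonpos_of_nonpos_of_nonneg (neg_nonpos.2 (sq_nonneg _)) (by positivity)
  have h : gaussianReal 0 v (Set.Icc (-r) r) ≤ ENNReal.ofReal (2 * r) := by
    rw [gaussianReal_apply 0 hv0]
    calc _ ≤ ∫⁻ _x in Set.Icc (-r) r, 1 := by
          refine lintegral_mono fun x => ?_
          rw [gaussianPDF]; exact ENNReal.ofReal_le_one.2 (hpdf x)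
      _ = _ := by simp [← two_mul]
  exact ENNReal.toReal_le_of_le_ofReal (by positivity) h

lemma multivariateGaussian_real_abs_apply_le {S : Matrix (Fin d) (Fin d) ℝ} (hS : S.PosSemidef)
    {i : Fin d} (hi : 1 / 4 ≤ S i i) {r : ℝ} (hr : 0 ≤ r) :
    (multivariateGaussian 0 S).real {y | |y i| ≤ r} ≤ 2 * r := by
  have h := measurePreserving_eval_multivariateGaussian (μ := 0) hS (i := i)
  have hset : {y : EuclideanSpace ℝ (Fin d) | |y i| ≤ r} =
      (fun y : EuclideanSpace ℝ (Fin d) => y i) ⁻¹' Set.Icc (-r) r := by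
    ext y; simp [abs_le]
  rw [hset, h.measureReal_preimage measurableSet_Icc.nullMeasurableSet]
  refine gaussianReal_real_Icc_le ?_ hr
  rw [← NNReal.coe_le_coe, Real.coe_toNNReal _ (by linarith)]
  simpa using hi

open Matrix in
lemma multivariateGaussian_real_le_abs_inner {S : Matrix (Fin d) (Fin d) ℝ} (hS : S.PosSemidef)
    (x : EuclideanSpace ℝ (Fin d)) {c : ℝ} (hc : 0 < c) :
    (multivariateGaussian 0 S).real {y | c ≤ |inner ℝ x y|} ≤ (x ⬝ᵥ S *ᵥ x) / c ^ 2 := by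
  have hmem : MemLp id 2 (multivariateGaussian 0 S) := IsGaussian.memLp_two_id
  have hL : MemLp (fun y : EuclideanSpace ℝ (Fin d) => inner ℝ x y) 2 (multivariateGaussian 0 S) :=
    hmem.const_inner (𝕜 := ℝ) x
  have hE : ∫ y, inner ℝ x y ∂(multivariateGaussian 0 S) = 0 := by
    have := integral_inner (𝕜 := ℝ) (hmem.integrable (by norm_num)) x
    simpa using this
  have hV : Var[fun y => inner ℝ x y; multivariateGaussian 0 S] = x ⬝ᵥ S *ᵥ x := by
    rw [← covarianceBilin_self hmem, covarianceBilin_multivariateGaussian hS]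
  have h := meas_ge_le_variance_div_sq hL hc
  rw [hE, hV] at h
  simp only [sub_zero] at h
  refine ENNReal.toReal_le_of_le_ofReal ?_ h
  rw [← hV]
  exact div_nonneg (variance_nonneg _ _) (sq_nonneg _)

end Tails

/-! ### Strips around lines -/

section PairedStrip

open Matrix

variable {d m : ℕ}

/-- The points close to the line of slope `t` in the plane of the coordinates `i`, `k`, and away
from the origin. -/
def pairedStrip (i k : Fin d) (t c r : ℝ) : Set (EuclideanSpace ℝ (Fin d)) :=
  {y | |y k - t * y i| < c ∧ r < |y i|}

lemma measurableSet_pairedStrip (i k : Fin d) (t c r : ℝ) :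
    MeasurableSet (pairedStrip i k t c r) := by
  refine MeasurableSet.inter (s₁ := {y : EuclideanSpace ℝ (Fin d) | |y k - t * y i| < c})
    (s₂ := {y | r < |y i|}) ?_ ?_
  · exact measurableSet_lt (by fun_prop) measurable_const
  · exact measurableSet_lt measurable_const (by fun_prop)

lemma abs_sub_mul_lt_of_mem_pairedStrip {i k : Fin d} {t t' c r : ℝ}
    {y : EuclideanSpace ℝ (Fin d)} (h : y ∈ pairedStrip i k t c r)
    (h' : y ∈ pairedStrip i k t' c r) : |t - t'| * r < 2 * c := by
  have h1 : |t - t'| * |y i| ≤ |y k - t' * y i| + |y k - t * y i| := by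
    rw [← abs_mul, show (t - t') * y i = y k - t' * y i - (y k - t * y i) by ring]
    exact abs_sub _ _
  have h2 : |t - t'| * r ≤ |t - t'| * |y i| := mul_le_mul_of_nonneg_left h.2.le (abs_nonneg _)
  linarith [h.1, h'.1]

/-- The two losses are Chebyshev in the thin normal direction and the small-ball bound for the
coordinate `a j`, whose variance exceeds `1 / 4`. -/
lemma one_sub_le_multivariateGaussian_pairedStrip {κ : ℝ} (hκ : 0 < κ) {a b : Fin m → Fin d}
    (hab : Function.Injective (Sum.elim a b)) {t : Fin m → ℝ} (j : Fin m) (ht : |t j| ≤ 1)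
    {c r : ℝ} (hc : 0 < c) (hr : 0 ≤ r) :
    1 - (2 / (κ * c ^ 2) + 2 * r) ≤ (multivariateGaussian 0 (pairedCov κ a b t)).real
      (pairedStrip (a j) (b j) (t j) c r) := by
  set μ := multivariateGaussian 0 (pairedCov κ a b t)
  have hS := posSemidef_pairedCov hκ.le a b t
  let x : EuclideanSpace ℝ (Fin d) :=
    WithLp.toLp 2 (Pi.single (b j) 1 - t j • Pi.single (a j) 1)
  have hx : ∀ y : EuclideanSpace ℝ (Fin d), inner ℝ x y = y (b j) - t j * y (a j) := by
    intro y
    simp [x, PiLp.inner_apply, mul_comm, sub_mul, Finset.sum_sub_distrib]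
  have h1 := multivariateGaussian_real_le_abs_inner hS x hc
  have h2 := multivariateGaussian_real_abs_apply_le hS (i := a j) (r := r)
    (by rw [pairedCov_apply_left hab]; linarith [one_div_pos.2 hκ]) hr
  have h3 : x ⬝ᵥ pairedCov κ a b t *ᵥ x ≤ 1 / κ * 2 := by
    refine (dotProduct_pairedCov_mulVec_normal hab κ t j).trans_le ?_
    have : t j ^ 2 ≤ 1 := (sq_le_one_iff_abs_le_one _).2 ht
    gcongr
    linarith
  have h4 : (x ⬝ᵥ pairedCov κ a b t *ᵥ x) / c ^ 2 ≤ 2 / (κ * c ^ 2) := by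
    calc _ ≤ 1 / κ * 2 / c ^ 2 := by gcongr
      _ = _ := by field_simp
  have hcompl : (pairedStrip (a j) (b j) (t j) c r)ᶜ ⊆
      {y | c ≤ |inner ℝ x y|} ∪ {y | |y (a j)| ≤ r} := by
    intro y hy
    by_contra hcon
    simp only [Set.mem_union, Set.mem_ofPred_eq, not_or, not_le, hx] at hcon
    exact hy hcon
  have h5 := (measureReal_mono (μ := μ) hcompl).trans (measureReal_union_le _ _)
  rw [probReal_compl_eq_one_sub (measurableSet_pairedStrip _ _ _ _ _)] at h5
  linarith

end PairedStrip

/-! ### Choice of parameters and conclusion -/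

/-- The common core of the two bounds: an accurate sampler has many outputs at some sample point. -/
lemma rpow_le_of_card_image_le {δ : ℝ} (hδ0 : 0 ≤ δ) (hδ1 : δ < 1) {d : ℕ} (hd : 2 ≤ d) {u : ℝ}
    (hu : 200 / (1 - δ) ^ 2 ≤ u) {Ω : Type*} [MeasurableSpace Ω] (P : Measure Ω)
    [IsProbabilityMeasure P] [DecidableEq (EuclideanSpace ℝ (Fin d))]
    {Y : CovClass d (u ^ 16) → Ω → EuclideanSpace ℝ (Fin d)}
    (hY : IsTVAccurate P Y gaussianTarget δ) {M : ℝ}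
    (hM : ∀ ω (s : Finset (CovClass d (u ^ 16))), ((s.image fun S => Y S ω).card : ℝ) ≤ M) :
    u ^ (d / 2) ≤ M := by
  classical
  set γ := 1 - δ with hγ
  have hγ0 : 0 < γ := by linarith
  have hγ1 : γ ≤ 1 := by linarith
  have huγ : 200 ≤ u * γ ^ 2 := by rwa [div_le_iff₀ (by positivity)] at hu
  have hu200 : 200 ≤ u := by
    refine le_trans ?_ hu
    rw [le_div_iff₀ (by positivity)]
    nlinarith
  have hu0 : 0 < u := by linarith
  set m := d / 2 with hm
  have hm0 : 0 < m := by omega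
  set R := ⌊u ^ 2⌋₊ with hR
  have hRle : (R : ℝ) ≤ u ^ 2 := Nat.floor_le (by positivity)
  have hRgt : u ^ 2 < R + 1 := Nat.lt_floor_add_one _
  have hRu : u ^ 2 / 2 ≤ R := by nlinarith
  have hR0 : 0 < R := by
    have : (0 : ℝ) < R := by nlinarith
    exact_mod_cast this
  have hR0' : (0 : ℝ) < R := by exact_mod_cast hR0
  let a : Fin m → Fin d := fun j => ⟨j, by omega⟩
  let b : Fin m → Fin d := fun j => ⟨m + j, by omega⟩
  have hab : Function.Injective (Sum.elim a b) := by
    rintro (j | j) (k | k) h <;> simp [a, b, Fin.ext_iff] at h ⊢ <;> omega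
  let t : Fin (R ^ 2) → ℝ := fun k => k / (R : ℝ) ^ 2
  have ht : ∀ k, |t k| ≤ 1 := by
    intro k
    have hk : (k : ℝ) ≤ (R : ℝ) ^ 2 := by exact_mod_cast k.2.le
    rw [abs_of_nonneg (by positivity)]
    exact div_le_one_of_le₀ hk (by positivity)
  have hκ : (2 : ℝ) ≤ u ^ 16 := by
    calc (2 : ℝ) ≤ u := by linarith
      _ ≤ u ^ 16 := le_self_pow₀ (by linarith) (by norm_num)
  let S : (Fin m → Fin (R ^ 2)) → CovClass d (u ^ 16) := fun i =>
    ⟨pairedCov (u ^ 16) a b fun j => t (i j), pairedCov_mem hκ hab fun j => ht (i j)⟩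
  -- The half-width is `4 / γ` times `κ ^ (-1/2) = u ^ (-8)`. Both losses, `2 / (κ c²) = γ² / 8` and
  -- `2r = γ / 8`, are then at most `γ / 8`.
  let G : Fin m → Fin (R ^ 2) → Set (EuclideanSpace ℝ (Fin d)) := fun j k =>
    pairedStrip (a j) (b j) (t k) (4 / γ / u ^ 8) (γ / 16)
  have hGm : ∀ j k, MeasurableSet (G j k) := fun j k => measurableSet_pairedStrip _ _ _ _ _
  let A : (Fin m → Fin (R ^ 2)) → Set (EuclideanSpace ℝ (Fin d)) := fun i =>
    majoritySet fun j => G j (i j)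
  have hAm : ∀ i, MeasurableSet (A i) := fun i => measurableSet_majoritySet fun j => hGm j (i j)
  have hdisj : ∀ y j k l, y ∈ G j k → y ∈ G j l → k = l := by
    intro y j k l hk hl
    by_contra hne
    have h := abs_sub_mul_lt_of_mem_pairedStrip hk hl
    have hkl : (1 : ℝ) ≤ |(k : ℝ) - l| := by
      have : (1 : ℤ) ≤ |(k : ℤ) - l| := Int.one_le_abs (by
        intro h0; exact hne (Fin.ext (by omega)))
      exact_mod_cast this
    have ht' : 1 / u ^ 4 ≤ |t k - t l| := by
      simp only [t]
      rw [← sub_div, abs_div, abs_of_nonneg (by positivity : (0 : ℝ) ≤ (R : ℝ) ^ 2)]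
      refine div_le_div₀ (abs_nonneg _) hkl (by positivity) ?_
      calc (R : ℝ) ^ 2 ≤ (u ^ 2) ^ 2 := by gcongr
        _ = u ^ 4 := by ring
    have h1 : 1 / u ^ 4 * (γ / 16) < 2 * (4 / γ / u ^ 8) :=
      (mul_le_mul_of_nonneg_right ht' (by positivity)).trans_lt h
    -- Overlapping strips would force this, against `200 ≤ u * γ ^ 2`.
    have h2 : u ^ 4 * γ ^ 2 < 128 := by
      rw [← sub_pos] at h1 ⊢
      have : 128 - u ^ 4 * γ ^ 2 =
          (2 * (4 / γ / u ^ 8) - 1 / u ^ 4 * (γ / 16)) * (16 * γ * u ^ 8) := by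
        field_simp; ring
      rw [this]; positivity
    have h3 : u ≤ u ^ 4 := le_self_pow₀ (by linarith) (by norm_num)
    nlinarith [mul_le_mul_of_nonneg_right h3 (sq_nonneg γ)]
  have hprob : ∀ i, 1 - γ / 2 ≤ (gaussianTarget (S i)).real (A i) := by
    intro i
    have hstrip : ∀ j, 1 - γ / 4 ≤ (multivariateGaussian 0 (S i).1).real (G j (i j)) := by
      intro j
      have h := one_sub_le_multivariateGaussian_pairedStrip (by linarith : (0 : ℝ) < u ^ 16) hab
        (t := fun j => t (i j)) j (ht (i j)) (c := 4 / γ / u ^ 8) (r := γ / 16)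
        (by positivity) (by positivity)
      refine le_trans ?_ h
      have : 2 / (u ^ 16 * (4 / γ / u ^ 8) ^ 2) = γ ^ 2 / 8 := by field_simp; norm_num
      rw [this]
      nlinarith
    have h := one_sub_two_mul_le_measureReal_majoritySet (multivariateGaussian 0 (S i).1) hm0
      (fun j => hGm j (i j)) hstrip
    refine le_trans (by linarith) h
  have hsum := sum_measureReal_map_le P (Y := fun i => Y (S i)) (fun i => (hY (S i)).1) hAm
    (M := M) (L := (2 * R : ℝ) ^ m) (by positivity)
    (fun ω => by simpa [Finset.image_image, Function.comp_def] using hM ω (Finset.univ.image S))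
    fun y => sum_indicator_majoritySet_le hR0 G y (hdisj y)
  -- Success probability `1 - γ / 2` under the target drops by at most `δ = 1 - γ`, leaving `γ / 2`.
  have hlow : ((R : ℝ) ^ 2) ^ m * (γ / 2) ≤ M * (2 * R : ℝ) ^ m := by
    refine le_trans ?_ hsum
    calc ((R : ℝ) ^ 2) ^ m * (γ / 2) = ∑ _i : Fin m → Fin (R ^ 2), γ / 2 := by simp
      _ ≤ _ := Finset.sum_le_sum fun i _ => by
        have : IsProbabilityMeasure (P.map (Y (S i))) :=
          Measure.isProbabilityMeasure_map (hY (S i)).1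
        have : IsProbabilityMeasure (gaussianTarget (S i)) :=
          inferInstanceAs (IsProbabilityMeasure (multivariateGaussian 0 (S i).1))
        have h1 := abs_measureReal_sub_le_tvDist (P.map (Y (S i))) (gaussianTarget (S i)) (hAm i)
        have h2 := (abs_le.1 (h1.trans (hY (S i)).2)).1
        linarith [hprob i]
  -- The single factor `γ / 2` is replaced by one per pair, so it can be absorbed into the base
  -- uniformly in `m`.
  have hγm : (γ / 2) ^ m ≤ γ / 2 :=
    pow_le_of_le_one (by positivity) (by linarith) hm0.ne'
  have hur : u ≤ R / 2 * (γ / 2) := by nlinarith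
  have hpos : (0 : ℝ) < (2 * R : ℝ) ^ m := by positivity
  refine le_of_mul_le_mul_right ?_ hpos
  calc u ^ m * (2 * R : ℝ) ^ m ≤ (R / 2 * (γ / 2)) ^ m * (2 * R : ℝ) ^ m := by gcongr
    _ = ((R : ℝ) ^ 2) ^ m * (γ / 2) ^ m := by
        rw [← mul_pow, ← mul_pow]; congr 1; ring
    _ ≤ ((R : ℝ) ^ 2) ^ m * (γ / 2) := by gcongr
    _ ≤ _ := hlow

lemma logb_mul_le_of_pow_le_two_rpow {d : ℕ} (hd : 2 ≤ d) {u Q : ℝ} (hu : 1 ≤ u)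
    (h : u ^ (d / 2) ≤ (2 : ℝ) ^ Q) : 1 / 48 * d * Real.logb 2 (u ^ 16) ≤ Q := by
  have hlog := Real.logb_le_logb_of_le one_lt_two (by positivity) h
  rw [Real.logb_rpow two_pos (by norm_num), Real.logb_pow] at hlog
  have h0 : 0 ≤ Real.logb 2 u := Real.logb_nonneg one_lt_two hu
  -- The worst case of the floor is `d = 3`; with the exponent 16 this gives `1 / 48 = 1 / (3 *
  -- 16)`.
  have hd' : (d : ℝ) ≤ 3 * (d / 2 : ℕ) := by
    have : d ≤ 3 * (d / 2) := by omega
    exact_mod_cast this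
  rw [Real.logb_pow]
  push_cast
  nlinarith [mul_le_mul_of_nonneg_right hd' h0]

theorem mainTheorem2 (δ : ℝ) (hδ0 : 0 ≤ δ) (hδ1 : δ < 1) :
    ∃ c : ℝ, 0 < c ∧ ∃ κ₀ : ℝ, ∀ d : ℕ, 2 ≤ d → ∀ κ : ℝ, κ₀ ≤ κ →
      (∀ (Ω : Type*) [MeasurableSpace Ω] (P : Measure Ω) [IsProbabilityMeasure P]
          (T : Type*) [Fintype T] (Q : ℝ)
          (A : TranscriptSampler (CovClass d κ) Ω T (EuclideanSpace ℝ (Fin d))),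
          (Fintype.card T : ℝ) ≤ (2 : ℝ) ^ Q →
          IsTVAccurate P A.output gaussianTarget δ →
          c * d * Real.logb 2 κ ≤ Q) ∧
      (∀ (Ω : Type*) [MeasurableSpace Ω] (P : Measure Ω) [IsProbabilityMeasure P]
          (Q : ℕ) (A : ScoreSampler d Ω),
          (∀ (S : CovClass d κ) (ω : Ω), A.totalBits (gaussianTarget S) ω ≤ Q) →
          IsTVAccurate P (fun S : CovClass d κ => A.output (gaussianTarget S)) gaussianTarget δ →
          c * d * Real.logb 2 κ ≤ Q) := by
  refine ⟨1 / 48, by norm_num, (200 / (1 - δ) ^ 2) ^ 16, fun d hd κ hκ => ?_⟩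
  classical
  have hγ : (0 : ℝ) < (1 - δ) ^ 2 := pow_pos (by linarith) 2
  obtain ⟨u, hu, rfl⟩ : ∃ u : ℝ, 200 / (1 - δ) ^ 2 ≤ u ∧ u ^ 16 = κ := by
    have h0 : (0 : ℝ) ≤ 200 / (1 - δ) ^ 2 := by positivity
    have hκ0 : 0 ≤ κ := le_trans (by positivity) hκ
    have hroot : (κ ^ ((16 : ℕ) : ℝ)⁻¹) ^ 16 = κ := Real.rpow_inv_natCast_pow hκ0 (by norm_num)
    refine ⟨κ ^ ((16 : ℕ) : ℝ)⁻¹, ?_, hroot⟩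
    exact le_of_pow_le_pow_left₀ (by norm_num) (by positivity) (hκ.trans hroot.ge)
  have hu1 : 1 ≤ u := by
    refine le_trans ?_ hu
    rw [le_div_iff₀ hγ]
    nlinarith
  constructor
  · intro Ω _ P _ T _ Q A hT hA
    refine logb_mul_le_of_pow_le_two_rpow hd hu1
      (rpow_le_of_card_image_le hδ0 hδ1 hd hu P hA fun ω s => le_trans ?_ hT)
    -- For fixed `ω` the output depends on the target only through the transcript.
    have hsub : (s.image fun S => A.output S ω) ⊆
        (Finset.univ : Finset T).image fun τ => A.decode τ ω := by
      intro y hy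
      obtain ⟨S, -, rfl⟩ := Finset.mem_image.1 hy
      exact Finset.mem_image_of_mem (fun τ => A.decode τ ω) (Finset.mem_univ (A.transcript S ω))
    exact_mod_cast (Finset.card_le_card hsub).trans Finset.card_image_le
  · intro Ω _ P _ Q A hQ hA
    refine logb_mul_le_of_pow_le_two_rpow hd hu1
      (rpow_le_of_card_image_le hδ0 hδ1 hd hu P hA fun ω s => ?_)
    rw [Real.rpow_natCast]
    exact A.card_image_output_le gaussianTarget ω s fun S _ => hQ S ω
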